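/- Let $d_A,d_B\ge 1$, $\mathcal H_A=\mathbb C^{d_A}$, $\mathcal H_B=\mathbb C^{d_B}$ with computational bases $\{|a\rangle\}$, $\{|b\rangle\}$. For $\pi\in S_3$ let $W_\pi=\sum_{s}|s_{\pi(1)},s_{\pi(2)},s_{\pi(3)}\rangle\langle s_1,s_2,s_3|$ be the permutation operator on three copies of a system. For a probability measure $\mu$ on $U(d)$ let $\Phi^3_\mu(X)=\int U^{\otimes 3}X\,U^{\dagger\otimes 3}\,d\mu(U)$; $\mu$ is a unitary 3-design if $\Phi^3_\mu=\Phi^3_{\mathrm{Haar}}$ (in particular, $\mu$ may be the Haar probability measure). Let $\mu_A,\mu_B$ be unitary 3-designs on $U(d_A)$, $U(d_B)$, write $\Phi^3_A=\Phi^3_{\mu_A}$, $\Phi^3_B=\Phi^3_{\mu_B}$, and let $\Phi^3_A\otimes\Phi^3_B$ be the bi-local twirling channel, i.e. the average of $X\mapsto (U_A^{\otimes 3}\otimes U_B^{\otimes 3})X(U_A^{\otimes 3}\otimes U_B^{\otimes 3})^\dagger$ over independent $U_A\sim\mu_A$, $U_B\sim\mu_B$. Consider the computational-basis observables $O_A=\sum_{\vec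 a}O_A(\vec a)|\vec a\rangle\langle\vec a|$ and $O_B=\sum_{\vec b}O_B(\vec b)|\vec b\rangle\langle\vec b|$ with $$O_A(a,a',a'')=(d_A+1)\,\delta_{a,a'}-1,\qquad O_B(b,b',b'')=(d_B+1)\,\delta_{b',b''}-1 .$$ Then $$\Phi^3_A(O_A)=W^A_{(12)},\qquad \Phi^3_B(O_B)=W^B_{(23)},\qquad (\Phi^3_A\otimes\Phi^3_B)(O_A\otimes O_B)=M_c:=W^A_{(12)}\otimes W^B_{(23)} .$$ Consequently, for every density matrix $\rho_{AB}$ on $\mathcal H_A\otimes\mathcal H_B$ with marginals $\rho_A,\rho_B$, writing $P(a,b|U_A,U_B)=\mathrm{Tr}\big[(|a\rangle\langle a|\otimes|b\rangle\langle b|)(U_A\otimes U_B)\rho_{AB}(U_A\otimes U_B)^\dagger\big]$ for the outcome probabilities of a computational-basis measurement on a single copy, $$\mathrm{Tr}[\rho_{AB}(\rho_A\otimes\rho_B)]=\mathrm{Tr}[M_c\,\rho_{AB}^{\otimes 3}]=\sum_{\vec a,\vec b}O_A(\vec a)\,O_B(\vec b)\;\mathbb E_{U_A,U_B}\prod_{i=1}^{3}P(a_i,b_i|U_A,U_B).$$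 -/

import Mathlib

open MeasureTheory
open scoped Kronecker ComplexOrder

namespace RandomTwirl

/-- The unitary group `U(d)`, acting on `ℂ^d` with its computational basis indexed by `Fin d`. -/
abbrev U (d : ℕ) : Type := Matrix.unitaryGroup (Fin d) ℂ

noncomputable instance instMeasurableSpaceU (d : ℕ) : MeasurableSpace (U d) := borel (U d)

instance instBorelSpaceU (d : ℕ) : BorelSpace (U d) := ⟨rfl⟩

instance instCompactSpaceU (d : ℕ) : CompactSpace (U d) := by
  refine (isCompact_iff_compactSpace (s := (Matrix.unitaryGroup (Fin d) ℂ : Set (Matrix (Fin d) (Fin d) ℂ)))).mp ?_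
  have hK : IsCompact
      (Set.pi Set.univ (fun _ : Fin d => Set.pi Set.univ (fun _ : Fin d =>
        Metric.closedBall (0 : ℂ) 1))) :=
    isCompact_univ_pi fun _ => isCompact_univ_pi fun _ => isCompact_closedBall 0 1
  refine IsCompact.of_isClosed_subset hK (isClosed_unitary (R := Matrix (Fin d) (Fin d) ℂ)) ?_
  intro M hM i _ j _
  simpa using entry_norm_bound_of_unitary hM i j

/-- The Haar probability measure on `U(d)`. -/
noncomputable def haarU (d : ℕ) : Measure (U d) := Measure.haarMeasure ⊤

instance instIsHaarMeasureHaarU (d : ℕ) : (haarU d).IsHaarMeasure := by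
  unfold haarU; infer_instance

instance instIsProbabilityMeasureHaarU (d : ℕ) : IsProbabilityMeasure (haarU d) := by
  constructor
  have h := Measure.haarMeasure_self (K₀ := (⊤ : TopologicalSpace.PositiveCompacts (U d)))
  simpa [haarU] using h

/-- The `k`-fold tensor power `M^{⊗ k}`, in the product basis `|s_1, …, s_k⟩`. -/
def tensorPow {n : Type*} (k : ℕ) (M : Matrix n n ℂ) :
    Matrix (Fin k → n) (Fin k → n) ℂ :=
  Matrix.of fun s t => ∏ i, M (s i) (t i)

/-- The permutation operator
`W_π = ∑_s |s_{π(1)}, …, s_{π(k)}⟩⟨s_1, …, s_k|` on `(ℂ^d)^{⊗ k}`. -/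
def permOp (d : ℕ) {k : ℕ} (π : Equiv.Perm (Fin k)) :
    Matrix (Fin k → Fin d) (Fin k → Fin d) ℂ :=
  ∑ s : Fin k → Fin d, Matrix.single (fun i => s (π i)) s 1

/-- The `k`-fold twirling channel of an ensemble `μ` of unitaries,
`X ↦ ∫ U^{⊗ k} X (U^{⊗ k})† dμ(U)`, the integral being taken entry by entry. -/
noncomputable def twirl {d : ℕ} (k : ℕ) (μ : Measure (U d))
    (X : Matrix (Fin k → Fin d) (Fin k → Fin d) ℂ) :
    Matrix (Fin k → Fin d) (Fin k → Fin d) ℂ :=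
  Matrix.of fun s t => ∫ u : U d,
    (tensorPow k (u : Matrix (Fin d) (Fin d) ℂ) * X *
      (tensorPow k (u : Matrix (Fin d) (Fin d) ℂ)).conjTranspose) s t ∂μ

/-- A unitary `k`-design: its `k`-fold twirling channel is the one of the Haar measure. -/
def IsUnitaryDesign {d : ℕ} (k : ℕ) (μ : Measure (U d)) : Prop :=
  ∀ X : Matrix (Fin k → Fin d) (Fin k → Fin d) ℂ, twirl k μ X = twirl k (haarU d) X

theorem isUnitaryDesign_haarU (d k : ℕ) : IsUnitaryDesign k (haarU d) := fun _ => rfl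

/-- The bi-local twirling channel `Φ_A^k ⊗ Φ_B^k` on `H_A^{⊗ k} ⊗ H_B^{⊗ k}`: the average over
independent `U_A ∼ μA` and `U_B ∼ μB` of the conjugation by `U_A^{⊗ k} ⊗ U_B^{⊗ k}`. -/
noncomputable def biTwirl {dA dB : ℕ} (k : ℕ) (μA : Measure (U dA)) (μB : Measure (U dB))
    (X : Matrix ((Fin k → Fin dA) × (Fin k → Fin dB)) ((Fin k → Fin dA) × (Fin k → Fin dB)) ℂ) :
    Matrix ((Fin k → Fin dA) × (Fin k → Fin dB)) ((Fin k → Fin dA) × (Fin k → Fin dB)) ℂ :=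
  Matrix.of fun s t => ∫ p : U dA × U dB,
    ((tensorPow k (p.1 : Matrix (Fin dA) (Fin dA) ℂ) ⊗ₖ
        tensorPow k (p.2 : Matrix (Fin dB) (Fin dB) ℂ)) * X *
      (tensorPow k (p.1 : Matrix (Fin dA) (Fin dA) ℂ) ⊗ₖ
        tensorPow k (p.2 : Matrix (Fin dB) (Fin dB) ℂ)).conjTranspose) s t ∂(μA.prod μB)

/-- The diagonal observable `∑_s f(s) |s⟩⟨s|` with real coefficients. -/
def diagObs {n : Type*} [DecidableEq n] (f : n → ℝ) : Matrix n n ℂ :=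
  Matrix.diagonal fun s => (f s : ℂ)

/-- Post-processing coefficients of `A`: `(d + 1) δ_{a,a'} - 1` at `(a, a', a'')`. -/
def coeffA (d : ℕ) (a : Fin 3 → Fin d) : ℝ :=
  ((d : ℝ) + 1) * (if a 0 = a 1 then 1 else 0) - 1

/-- Post-processing coefficients of `B`: `(d + 1) δ_{b',b''} - 1` at `(b, b', b'')`. -/
def coeffB (d : ℕ) (b : Fin 3 → Fin d) : ℝ :=
  ((d : ℝ) + 1) * (if b 1 = b 2 then 1 else 0) - 1

/-- Density matrices. -/
structure IsState {n : Type*} [Fintype n] (ρ : Matrix n n ℂ) : Prop where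
  posSemidef : ρ.PosSemidef
  trace_eq_one : ρ.trace = 1

/-- The marginal `ρ_A = Tr_B ρ_AB`. -/
def marginalA {m n : Type*} [Fintype n] (ρ : Matrix (m × n) (m × n) ℂ) : Matrix m m ℂ :=
  Matrix.of fun a a' => ∑ b, ρ (a, b) (a', b)

/-- The marginal `ρ_B = Tr_A ρ_AB`. -/
def marginalB {m n : Type*} [Fintype m] (ρ : Matrix (m × n) (m × n) ℂ) : Matrix n n ℂ :=
  Matrix.of fun b b' => ∑ a, ρ (a, b) (a, b')

/-- `ρ_AB^{⊗ k}`, with its tensor factors regrouped as `H_A^{⊗ k} ⊗ H_B^{⊗ k}`. -/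
def copies {m n : Type*} (k : ℕ) (ρ : Matrix (m × n) (m × n) ℂ) :
    Matrix ((Fin k → m) × (Fin k → n)) ((Fin k → m) × (Fin k → n)) ℂ :=
  Matrix.of fun s t => tensorPow k ρ (fun i => (s.1 i, s.2 i)) (fun i => (t.1 i, t.2 i))

/-- The probability `P(a, b | U_A, U_B)` of the outcome `(a, b)` when a single copy of
`(U_A ⊗ U_B) ρ_AB (U_A ⊗ U_B)†` is measured in the computational basis, by the Born rule. -/
def outcomeProb {dA dB : ℕ} (ρ : Matrix (Fin dA × Fin dB) (Fin dA × Fin dB) ℂ)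
    (uA : U dA) (uB : U dB) (a : Fin dA) (b : Fin dB) : ℂ :=
  ((Matrix.single a a (1 : ℂ) ⊗ₖ Matrix.single b b (1 : ℂ)) *
    (((uA : Matrix (Fin dA) (Fin dA) ℂ) ⊗ₖ (uB : Matrix (Fin dB) (Fin dB) ℂ)) * ρ *
      ((uA : Matrix (Fin dA) (Fin dA) ℂ) ⊗ₖ
        (uB : Matrix (Fin dB) (Fin dB) ℂ)).conjTranspose)).trace

/-- `M_c = W_(12)^A ⊗ W_(23)^B`; the copies `1, 2, 3` are indexed by `0, 1, 2 : Fin 3`. -/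
def Mc (dA dB : ℕ) :
    Matrix ((Fin 3 → Fin dA) × (Fin 3 → Fin dB)) ((Fin 3 → Fin dA) × (Fin 3 → Fin dB)) ℂ :=
  permOp dA (Equiv.swap (0 : Fin 3) 1) ⊗ₖ permOp dB (Equiv.swap (1 : Fin 3) 2)

end RandomTwirl

/-! Conjugating `diagObs (coeffA d)` by `u^{⊗3}` leaves the identity on the third copy and gives (d
+ 1) `quartic` minus the identity on the first two. So all reduces to one Haar moment,
`colMoment_eq`: (d + 1) E[`quartic`] is identity plus swap. The -1 in the coefficient removes the
identity and the swap remains; B is the same on copies 2 and 3. The moment needs no Weingarten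
calculus. Phase invariance kills it unless {s, s'} = {t, t'} as multisets; invariance under one
explicit rotation fixes the ratio 2 : 1 between equal and distinct indices; unitarity fixes the
scale. For the estimator, the Born probabilities of `ρ^{⊗3}` are moved to the Heisenberg picture,
where the design condition enters through its adjoint. Contracting `Mc` with three copies of ρ then
gives the marginals. -/

namespace RandomTwirl

/-! ### Integration over the compact group U(d) -/

section Integration

/-- Makes the product σ-algebra on `U dA × U dB` the Borel one, so continuous functions of a pair
are integrable. -/
instance instSecondCountableTopologyU (d : ℕ) : SecondCountableTopology (U d) := by
  have : SecondCountableTopology (Matrix (Fin d) (Fin d) ℂ) :=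
    inferInstanceAs (SecondCountableTopology (Fin d → Fin d → ℂ))
  exact TopologicalSpace.Subtype.secondCountableTopology _

theorem continuous_entry {d : ℕ} (i j : Fin d) :
    Continuous fun u : U d => (u : Matrix (Fin d) (Fin d) ℂ) i j :=
  Continuous.matrix_elem continuous_subtype_val i j

theorem continuous_tensorPow {d : ℕ} (k : ℕ) :
    Continuous fun u : U d => tensorPow k (u : Matrix (Fin d) (Fin d) ℂ) :=
  continuous_matrix fun s t => by
    simp only [tensorPow, Matrix.of_apply]
    exact continuous_finsetProd _ fun i _ => continuous_entry (s i) (t i)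

theorem integrable_of_continuous {X : Type*} [TopologicalSpace X] [CompactSpace X]
    [MeasurableSpace X] [OpensMeasurableSpace X] (μ : Measure X) [IsFiniteMeasure μ]
    {f : X → ℂ} (hf : Continuous f) : Integrable f μ :=
  hf.integrable_of_hasCompactSupport (HasCompactSupport.of_compactSpace f)

/-- Only left invariance is used: average f(x⁻¹ y) over both variables. Integrating y first gives
the mean of f, integrating x first gives the mean of f(u⁻¹). -/
theorem integral_inv_haarU {d : ℕ} {f : U d → ℂ} (hf : Continuous f) :
    ∫ u, f u⁻¹ ∂haarU d = ∫ u, f u ∂haarU d := by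
  calc ∫ x, f x⁻¹ ∂haarU d = ∫ y, (∫ x, f (y⁻¹ * x)⁻¹ ∂haarU d) ∂haarU d := by
        simp_rw [integral_mul_left_eq_self (μ := haarU d) (fun x => f x⁻¹)]
        simp
    _ = ∫ y, (∫ x, f (x⁻¹ * y) ∂haarU d) ∂haarU d := by simp
    _ = ∫ x, (∫ y, f (x⁻¹ * y) ∂haarU d) ∂haarU d := by
        refine integral_integral_swap (integrable_of_continuous _ ?_)
        exact hf.comp (continuous_snd.inv.mul continuous_fst)
    _ = ∫ u, f u ∂haarU d := by
        simp_rw [integral_mul_left_eq_self (μ := haarU d) f]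
        simp

end Integration

/-! ### The fourth-order Haar moment, by symmetry -/

section ColumnMoments

/-- The quartic expression `∑_a u_{sa} u_{s'a} conj u_{ta} conj u_{t'a}` in the entries of `u`. -/
noncomputable def quartic {d : ℕ} (s s' t t' : Fin d) (u : U d) : ℂ :=
  ∑ a, u.1 s a * u.1 s' a * star (u.1 t a) * star (u.1 t' a)

theorem continuous_quartic {d : ℕ} (s s' t t' : Fin d) : Continuous (quartic s s' t t') :=
  continuous_finsetSum _ fun a _ => (((continuous_entry s a).mul (continuous_entry s' a)).mul
    (continuous_entry t a).star).mul (continuous_entry t' a).star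

/-- The Haar average of `quartic`. -/
noncomputable def colMoment {d : ℕ} (s s' t t' : Fin d) : ℂ :=
  ∫ u, quartic s s' t t' u ∂haarU d

theorem colMoment_swap_left {d : ℕ} (s s' t t' : Fin d) :
    colMoment s s' t t' = colMoment s' s t t' := by
  unfold colMoment quartic; congr 1; ext u; congr 1; ext a; ring

theorem colMoment_swap_right {d : ℕ} (s s' t t' : Fin d) :
    colMoment s s' t t' = colMoment s s' t' t := by
  unfold colMoment quartic; congr 1; ext u; congr 1; ext a; ring

theorem colMoment_eq_left_mul {d : ℕ} (v : U d) (s s' t t' : Fin d) :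
    colMoment s s' t t' = ∫ u, quartic s s' t t' (v * u) ∂haarU d :=
  (integral_mul_left_eq_self (μ := haarU d) (quartic s s' t t') v).symm

/-- The diagonal unitary with entry `i` at position `j` and `1` elsewhere. -/
noncomputable def phase {d : ℕ} (j : Fin d) : U d :=
  ⟨Matrix.diagonal fun i => if i = j then Complex.I else 1, by
    rw [Matrix.mem_unitaryGroup_iff, Matrix.star_eq_conjTranspose, Matrix.diagonal_conjTranspose,
      Matrix.diagonal_mul_diagonal, ← Matrix.diagonal_one]
    congr 1; ext i
    by_cases h : i = j <;> simp [h]⟩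

/-- Invariance under `phase j` multiplies the moment by I^n, with n the multiplicity of j in (s, s')
minus that in (t, t'). Since |n| ≤ 2 and I has order 4, a nonzero moment forces n = 0; taking j = s
and j = s' makes the two pairs equal as multisets. -/
theorem colMoment_eq_zero {d : ℕ} {s s' t t' : Fin d}
    (h : ¬ ((s = t ∧ s' = t') ∨ (s = t' ∧ s' = t))) : colMoment s s' t t' = 0 := by
  have key : ∀ j : Fin d, colMoment s s' t t' =
      ((if s = j then Complex.I else 1) * (if s' = j then Complex.I else 1) *
        star (if t = j then Complex.I else 1) * star (if t' = j then Complex.I else 1)) *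
        colMoment s s' t t' := by
    intro j
    conv_lhs => rw [colMoment_eq_left_mul (phase j)]
    rw [colMoment, ← integral_const_mul]
    congr 1; ext u
    simp only [quartic, Finset.mul_sum, phase, Submonoid.coe_mul, Matrix.diagonal_mul, star_mul']
    refine Finset.sum_congr rfl fun a _ => ?_
    ring
  by_contra h0
  have key' : ∀ j, (if s = j then Complex.I else 1) * (if s' = j then Complex.I else 1) *
        star (if t = j then Complex.I else 1) * star (if t' = j then Complex.I else 1) = 1 :=
    fun j => mul_right_cancel₀ h0 (by rw [one_mul]; exact (key j).symm)
  have h1 := key' s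
  have h2 := key' s'
  -- The possible values of I^n for 0 < |n| ≤ 2 are I, -I and -1.
  have hI : Complex.I ≠ 1 := fun h => by simpa using congrArg Complex.re h
  have hI' : -Complex.I ≠ 1 := fun h => by simpa using congrArg Complex.re h
  have hm : (-1 : ℂ) ≠ 1 := by norm_num
  have h' : ¬ ((t = s ∧ t' = s') ∨ (t' = s ∧ t = s')) := by
    simpa only [eq_comm] using h
  have a0 : s = s' ↔ s' = s := eq_comm
  by_cases a1 : s' = s <;> by_cases a2 : t = s <;> by_cases a3 : t' = s <;>
    by_cases a4 : t = s' <;> by_cases a5 : t' = s' <;>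
    simp [a0, a1, a2, a3, a4, a5, hI, hI', hm] at h' h1 h2

/-- The unitary `(3 + 4 i P) / 5`, with `P` the transposition of the basis vectors `j`, `k`. -/
noncomputable def rotation {d : ℕ} (j k : Fin d) : U d :=
  ⟨(3 / 5 : ℂ) • (1 : Matrix (Fin d) (Fin d) ℂ) +
      (4 / 5 * Complex.I) • (Equiv.swap j k).permMatrix ℂ, by
    have hP : (Equiv.swap j k).permMatrix ℂ * (Equiv.swap j k).permMatrix ℂ = 1 := by
      rw [← Matrix.permMatrix_mul, Equiv.swap_mul_self, Matrix.permMatrix_one]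
    have hS : ((Equiv.swap j k).permMatrix ℂ).conjTranspose = (Equiv.swap j k).permMatrix ℂ := by
      rw [Matrix.conjTranspose_permMatrix, Equiv.swap_inv]
    rw [Matrix.mem_unitaryGroup_iff, Matrix.star_eq_conjTranspose]
    simp only [Matrix.conjTranspose_add, Matrix.conjTranspose_smul, hS, Matrix.conjTranspose_one,
      add_mul, mul_add, smul_mul_smul_comm, hP, mul_one, one_mul]
    have e1 : star (3 / 5 : ℂ) = 3 / 5 := by simp
    have e2 : star (4 / 5 * Complex.I : ℂ) = -(4 / 5 * Complex.I) := by simp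
    rw [e1, e2]
    have hI : (4 / 5 * Complex.I) * -(4 / 5 * Complex.I) = 16 / 25 := by
      linear_combination (-16 / 25) * Complex.I_sq
    rw [hI]
    module⟩

theorem rotation_mul_apply {d : ℕ} (j k : Fin d) (u : U d) (a : Fin d) :
    (rotation j k * u).1 j a = 3 / 5 * u.1 j a + 4 / 5 * Complex.I * u.1 k a := by
  simp only [rotation, Submonoid.coe_mul, add_mul, Matrix.add_apply, smul_mul_assoc, one_mul,
    Matrix.smul_apply, smul_eq_mul, PEquiv.toMatrix_toPEquiv_mul, Matrix.submatrix_apply,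
    Equiv.swap_apply_left, id_eq]

/-- The Pythagorean triple 3, 4, 5 keeps the unitary rational up to I. Expanding the fourth-order
product for row j gives nine moments, six of which vanish by `colMoment_eq_zero`. -/
theorem colMoment_rotation {d : ℕ} {j k : Fin d} (hjk : j ≠ k) :
    625 * colMoment j j j j =
      81 * colMoment j j j j + 256 * colMoment k k k k + 576 * colMoment j k j k := by
  have hp : ∀ u : U d, 625 * quartic j j j j (rotation j k * u) =
      81 * quartic j j j j u + 256 * quartic k k k k u + 576 * quartic j k j k u +
      (-216 * Complex.I) * quartic j j j k u + (-144) * quartic j j k k u +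
      (216 * Complex.I) * quartic j k j j u + (-384 * Complex.I) * quartic j k k k u +
      (-144) * quartic k k j j u + (384 * Complex.I) * quartic k k j k u := by
    intro u
    simp only [quartic, Finset.mul_sum, ← Finset.sum_add_distrib]
    refine Finset.sum_congr rfl fun a _ => ?_
    rw [rotation_mul_apply]
    have e : star (3 / 5 * u.1 j a + 4 / 5 * Complex.I * u.1 k a) =
        3 / 5 * star (u.1 j a) - 4 / 5 * Complex.I * star (u.1 k a) := by
      simp; ring
    rw [e]
    generalize star (u.1 j a) = x', star (u.1 k a) = y', u.1 j a = x, u.1 k a = y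
    have hI := Complex.I_sq
    have hI3 : Complex.I ^ 3 = -Complex.I := by linear_combination Complex.I * hI
    have hI4 : Complex.I ^ 4 = 1 := by linear_combination (Complex.I ^ 2 - 1) * hI
    ring_nf
    rw [hI, hI3, hI4]
    ring
  have hi : ∀ (c : ℂ) (s s' t t' : Fin d),
      Integrable (fun u => c * quartic s s' t t' u) (haarU d) := fun c s s' t t' =>
    integrable_of_continuous _ (continuous_const.mul (continuous_quartic s s' t t'))
  conv_lhs => rw [colMoment_eq_left_mul (rotation j k), ← integral_const_mul]
  simp_rw [hp]
  iterate 8 rw [integral_add (by fun_prop) (hi _ _ _ _ _)]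
  simp only [integral_const_mul]
  simp only [← colMoment.eq_1]
  rw [colMoment_eq_zero (s := j) (s' := j) (t := j) (t' := k) (by grind),
    colMoment_eq_zero (s := j) (s' := j) (t := k) (t' := k) (by grind),
    colMoment_eq_zero (s := j) (s' := k) (t := j) (t' := j) (by grind),
    colMoment_eq_zero (s := j) (s' := k) (t := k) (t' := k) (by grind),
    colMoment_eq_zero (s := k) (s' := k) (t := j) (t' := j) (by grind),
    colMoment_eq_zero (s := k) (s' := k) (t := j) (t' := k) (by grind)]
  ring

theorem two_mul_colMoment {d : ℕ} {j k : Fin d} (hjk : j ≠ k) :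
    2 * colMoment j k j k = colMoment j j j j := by
  have h1 := colMoment_rotation hjk
  have h2 := colMoment_rotation hjk.symm
  rw [colMoment_swap_left k j, colMoment_swap_right j k] at h2
  -- The weights 17 : 8 eliminate `colMoment k k k k`, since 17 · 256 = 8 · 544, where 544 = 625 -
  -- 81.
  linear_combination (-17 / 7200) * h1 - 8 / 7200 * h2

theorem row_sum {d : ℕ} (u : U d) (s t : Fin d) :
    ∑ a, u.1 s a * star (u.1 t a) = if s = t then 1 else 0 := by
  have h := congrFun (congrFun (Matrix.mem_unitaryGroup_iff.mp u.2) s) t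
  rwa [Matrix.mul_apply, Matrix.one_apply] at h

theorem column_sum {d : ℕ} (u : U d) (a : Fin d) :
    ∑ s, u.1 s a * star (u.1 s a) = 1 := by
  have h := congrFun (congrFun (Matrix.mem_unitaryGroup_iff'.mp u.2) a) a
  rw [Matrix.mul_apply, Matrix.one_apply_eq] at h
  rw [← h]
  exact Finset.sum_congr rfl fun s _ => mul_comm _ _

/-- Holds pointwise: the sum over k is the squared norm of a column, and what is left is that of row
s. -/
theorem sum_colMoment {d : ℕ} (s : Fin d) : ∑ k, colMoment s k s k = 1 := by
  simp only [colMoment]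
  rw [← integral_finsetSum _ fun k _ => integrable_of_continuous _ (continuous_quartic s k s k)]
  have h : ∀ u : U d, ∑ k, quartic s k s k u = 1 := by
    intro u
    simp only [quartic]
    rw [Finset.sum_comm, ← (row_sum u s s).trans (if_pos rfl)]
    refine Finset.sum_congr rfl fun a _ => ?_
    rw [← mul_one (u.1 s a * star (u.1 s a)), ← column_sum u a, Finset.mul_sum]
    exact Finset.sum_congr rfl fun k _ => by ring
  simp [h]

/-- With M the diagonal moment, the d - 1 other terms of `sum_colMoment` are M / 2 each, so M + (d -
1) M / 2 = 1. -/
theorem colMoment_self {d : ℕ} (s : Fin d) : ((d : ℂ) + 1) * colMoment s s s s = 2 := by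
  have h := sum_colMoment s
  rw [← Finset.add_sum_erase _ _ (Finset.mem_univ s),
    Finset.sum_congr rfl (g := fun _ => colMoment s s s s / 2) fun k hk => by
      rw [← two_mul_colMoment (Finset.ne_of_mem_erase hk).symm]; ring,
    Finset.sum_const, Finset.card_erase_of_mem (Finset.mem_univ s), Finset.card_univ,
    Fintype.card_fin, nsmul_eq_mul, Nat.cast_pred s.pos] at h
  linear_combination 2 * h

theorem colMoment_eq {d : ℕ} (s s' t t' : Fin d) :
    ((d : ℂ) + 1) * colMoment s s' t t' =
      (if s = t then 1 else 0) * (if s' = t' then 1 else 0) +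
      (if s = t' then 1 else 0) * (if s' = t then 1 else 0) := by
  by_cases h : (s = t ∧ s' = t') ∨ (s = t' ∧ s' = t)
  · by_cases hs : s = s'
    · have : s = t ∧ s = t' ∧ s' = t ∧ s' = t' := by grind
      obtain ⟨rfl, rfl, rfl, -⟩ := this
      rw [colMoment_self]; norm_num
    · have h1 : ((d : ℂ) + 1) * colMoment s s' s s' = 1 := by
        linear_combination (((d : ℂ) + 1) * two_mul_colMoment hs + colMoment_self s) / 2
      rcases h with ⟨rfl, rfl⟩ | ⟨rfl, rfl⟩
      · rw [h1]; simp [hs]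
      · rw [colMoment_swap_right, h1]; simp [hs]
  · rw [colMoment_eq_zero h]
    have : ¬ (s = t ∧ s' = t') ∧ ¬ (s = t' ∧ s' = t) := by tauto
    simp only [← ite_and, mul_ite, mul_one, mul_zero]
    rw [if_neg (by tauto), if_neg (by tauto)]
    simp

end ColumnMoments

/-! ### Twirling the observables, and the adjoint of a twirl -/

section Twirl

theorem sum_fin_three {α M : Type*} [Fintype α] [AddCommMonoid M]
    (F : (Fin 3 → α) → M) : ∑ f, F f = ∑ a, ∑ b, ∑ c, F ![a, b, c] := by
  classical
  rw [← (Fin.consEquiv fun _ : Fin 3 => α).sum_comp, Fintype.sum_prod_type]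
  refine Finset.sum_congr rfl fun a _ => ?_
  rw [← (finTwoArrowEquiv α).symm.sum_comp, Fintype.sum_prod_type]
  rfl

theorem permOp_apply {d k : ℕ} (π : Equiv.Perm (Fin k)) (s t : Fin k → Fin d) :
    permOp d π s t = if s = t ∘ π then 1 else 0 := by
  rw [permOp, Matrix.sum_apply, Finset.sum_eq_single t]
  · simp [Matrix.single_apply, eq_comm, Function.comp_def]
  · intro r _ hr
    simp [hr]
  · simp

theorem conj_diagObs_apply {d k : ℕ} (u : U d) (f : (Fin k → Fin d) → ℝ) (s t : Fin k → Fin d) :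
    (tensorPow k u.1 * diagObs f * (tensorPow k u.1).conjTranspose) s t =
      ∑ a, (f a : ℂ) * ∏ i, (u.1 (s i) (a i) * star (u.1 (t i) (a i))) := by
  rw [Matrix.mul_apply]
  refine Finset.sum_congr rfl fun a _ => ?_
  rw [diagObs, Matrix.mul_diagonal, Matrix.conjTranspose_apply, Finset.prod_mul_distrib]
  simp only [tensorPow, Matrix.of_apply, star_prod]
  ring

theorem sum_pair_coeff {α : Type*} [Fintype α] [DecidableEq α] (c : ℂ) (x y : α → ℂ) :
    ∑ a, ∑ b, (c * (if a = b then 1 else 0) - 1) * (x a * y b) =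
      c * ∑ a, x a * y a - (∑ a, x a) * ∑ b, y b := by
  rw [Finset.sum_mul_sum]
  simp [sub_mul, Finset.sum_sub_distrib, Finset.mul_sum, ite_mul]

theorem coeffA_vec {d : ℕ} (a b c : Fin d) :
    coeffA d ![a, b, c] = ((d : ℝ) + 1) * (if a = b then 1 else 0) - 1 := rfl

theorem conj_coeffA_apply {d : ℕ} (u : U d) (s t : Fin 3 → Fin d) :
    (tensorPow 3 u.1 * diagObs (coeffA d) * (tensorPow 3 u.1).conjTranspose) s t =
      (if s 2 = t 2 then 1 else 0) * (((d : ℂ) + 1) * quartic (s 0) (s 1) (t 0) (t 1) u -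
        (if s 0 = t 0 then 1 else 0) * (if s 1 = t 1 then 1 else 0)) := by
  rw [conj_diagObs_apply, sum_fin_three]
  simp only [coeffA_vec, Fin.prod_univ_three, Matrix.cons_val]
  -- The Kronecker deltas are turned back into row sums, so that both sides become the same triple
  -- sum.
  rw [← row_sum u (s 0), ← row_sum u (s 1), ← row_sum u (s 2)]
  have h := sum_pair_coeff ((d : ℂ) + 1) (fun a => u.1 (s 0) a * star (u.1 (t 0) a))
    fun a => u.1 (s 1) a * star (u.1 (t 1) a)
  have hq : quartic (s 0) (s 1) (t 0) (t 1) u = ∑ a, u.1 (s 0) a * star (u.1 (t 0) a) *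
      (u.1 (s 1) a * star (u.1 (t 1) a)) := Finset.sum_congr rfl fun a _ => by ring
  rw [hq, ← h, mul_comm, Finset.sum_mul]
  refine Finset.sum_congr rfl fun a _ => ?_
  rw [Finset.sum_mul]
  refine Finset.sum_congr rfl fun b _ => ?_
  rw [Finset.mul_sum]
  refine Finset.sum_congr rfl fun c _ => ?_
  split_ifs <;> push_cast <;> ring

theorem coeffB_vec {d : ℕ} (a b c : Fin d) :
    coeffB d ![a, b, c] = ((d : ℝ) + 1) * (if b = c then 1 else 0) - 1 := rfl

theorem conj_coeffB_apply {d : ℕ} (u : U d) (s t : Fin 3 → Fin d) :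
    (tensorPow 3 u.1 * diagObs (coeffB d) * (tensorPow 3 u.1).conjTranspose) s t =
      (if s 0 = t 0 then 1 else 0) * (((d : ℂ) + 1) * quartic (s 1) (s 2) (t 1) (t 2) u -
        (if s 1 = t 1 then 1 else 0) * (if s 2 = t 2 then 1 else 0)) := by
  rw [conj_diagObs_apply, sum_fin_three]
  simp only [coeffB_vec, Fin.prod_univ_three, Matrix.cons_val]
  rw [← row_sum u (s 0), ← row_sum u (s 1), ← row_sum u (s 2)]
  have h := sum_pair_coeff ((d : ℂ) + 1) (fun a => u.1 (s 1) a * star (u.1 (t 1) a))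
    fun a => u.1 (s 2) a * star (u.1 (t 2) a)
  have hq : quartic (s 1) (s 2) (t 1) (t 2) u = ∑ a, u.1 (s 1) a * star (u.1 (t 1) a) *
      (u.1 (s 2) a * star (u.1 (t 2) a)) := Finset.sum_congr rfl fun a _ => by ring
  rw [hq, ← h, Finset.sum_mul]
  refine Finset.sum_congr rfl fun a _ => ?_
  rw [Finset.mul_sum]
  refine Finset.sum_congr rfl fun b _ => ?_
  rw [Finset.mul_sum]
  refine Finset.sum_congr rfl fun c _ => ?_
  split_ifs <;> push_cast <;> ring

theorem integral_quartic_sub {d : ℕ} (e : ℂ) (s s' t t' : Fin d) :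
    ∫ u, e * (((d : ℂ) + 1) * quartic s s' t t' u -
        (if s = t then 1 else 0) * (if s' = t' then 1 else 0)) ∂haarU d =
      e * ((if s = t' then 1 else 0) * (if s' = t then 1 else 0)) := by
  have hi : Integrable (fun u => ((d : ℂ) + 1) * quartic s s' t t' u) (haarU d) :=
    integrable_of_continuous _ (continuous_const.mul (continuous_quartic s s' t t'))
  rw [integral_const_mul, integral_sub hi (integrable_const _), integral_const_mul,
    ← colMoment, colMoment_eq]
  simp

theorem twirl_haarU_coeffA (d : ℕ) :
    twirl 3 (haarU d) (diagObs (coeffA d)) = permOp d (Equiv.swap (0 : Fin 3) 1) := by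
  ext s t
  simp only [twirl, Matrix.of_apply, conj_coeffA_apply]
  rw [integral_quartic_sub, permOp_apply]
  simp only [← ite_and, mul_ite, mul_one, mul_zero]
  refine if_congr ?_ rfl rfl
  rw [funext_iff, Fin.forall_fin_succ, Fin.forall_fin_two]
  simp [Equiv.swap_apply_def]
  tauto

theorem twirl_haarU_coeffB (d : ℕ) :
    twirl 3 (haarU d) (diagObs (coeffB d)) = permOp d (Equiv.swap (1 : Fin 3) 2) := by
  ext s t
  simp only [twirl, Matrix.of_apply, conj_coeffB_apply]
  rw [integral_quartic_sub, permOp_apply]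
  simp only [← ite_and, mul_ite, mul_one, mul_zero]
  refine if_congr ?_ rfl rfl
  rw [funext_iff, Fin.forall_fin_succ, Fin.forall_fin_two]
  simp [Equiv.swap_apply_def]
  tauto

/-- The Hilbert–Schmidt adjoint of a twirl by a unitary design is the twirl by the Haar measure. -/
theorem integral_conjTranspose_tensorPow_mul {d k : ℕ} {μ : Measure (U d)} [IsProbabilityMeasure μ]
    (hμ : IsUnitaryDesign k μ) (X : Matrix (Fin k → Fin d) (Fin k → Fin d) ℂ)
    (s t : Fin k → Fin d) :
    ∫ u : U d, ((tensorPow k u.1).conjTranspose * X * tensorPow k u.1) s t ∂μ =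
      twirl k (haarU d) X s t := by
  have hc : Continuous fun u : U d => tensorPow k u.1 := continuous_tensorPow k
  have hcont : ∀ x y, Continuous fun u : U d =>
      (tensorPow k u.1 * Matrix.single t s (1 : ℂ) * (tensorPow k u.1).conjTranspose) x y := fun x y =>
    ((hc.matrix_mul continuous_const).matrix_mul hc.matrix_conjTranspose).matrix_elem x y
  -- With T = `tensorPow k u`, the (s, t) entry of T† X T is Tr(X T E_ts T†), which exposes the
  -- twirl of a matrix unit.
  have hexp : ∀ u : U d, ((tensorPow k u.1).conjTranspose * X * tensorPow k u.1) s t =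
      ∑ y, ∑ x, X x y *
        (tensorPow k u.1 * Matrix.single t s (1 : ℂ) * (tensorPow k u.1).conjTranspose) y x := by
    intro u
    simp only [Matrix.mul_apply, Finset.sum_mul]
    refine Finset.sum_congr rfl fun y _ => Finset.sum_congr rfl fun x _ => ?_
    simp [Matrix.single_apply, Finset.sum_ite_eq, ite_and]
    ring
  have hexpand : ∀ (ν : Measure (U d)) [IsProbabilityMeasure ν],
      ∫ u : U d, ((tensorPow k u.1).conjTranspose * X * tensorPow k u.1) s t ∂ν =
        ∑ y, ∑ x, X x y * twirl k ν (Matrix.single t s (1 : ℂ)) y x := by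
    intro ν _
    simp only [hexp]
    have hi : ∀ y x, Integrable (fun u : U d => X x y * (tensorPow k u.1 *
        Matrix.single t s (1 : ℂ) * (tensorPow k u.1).conjTranspose) y x) ν := fun y x =>
      integrable_of_continuous _ (continuous_const.mul (hcont y x))
    rw [integral_finsetSum _ fun y _ => integrable_finsetSum _ fun x _ => hi y x]
    refine Finset.sum_congr rfl fun y _ => ?_
    rw [integral_finsetSum _ fun x _ => hi y x]
    refine Finset.sum_congr rfl fun x _ => ?_
    rw [integral_const_mul]
    rfl
  -- The design property on matrix units replaces μ by Haar; inversion invariance then exchanges u†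
  -- and u.
  rw [hexpand μ, hμ, ← hexpand (haarU d), ← integral_inv_haarU
    (((hc.matrix_conjTranspose.matrix_mul continuous_const).matrix_mul hc).matrix_elem s t)]
  have hinv : ∀ u : U d, tensorPow k (u⁻¹).1 = (tensorPow k u.1).conjTranspose := by
    intro u
    ext x y
    simp [tensorPow, star_prod]
  simp only [hinv, Matrix.conjTranspose_conjTranspose]
  rfl

end Twirl

/-! ### Tensor powers of the state and the contraction with `Mc` -/

section Copies

/-- Regrouping the factors is the bijection between k-tuples of pairs and pairs of k-tuples, applied
to the summation index. -/
theorem copies_mul {m n : Type*} [Fintype m] [Fintype n] (k : ℕ)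
    (ρ σ : Matrix (m × n) (m × n) ℂ) : copies k (ρ * σ) = copies k ρ * copies k σ := by
  classical
  ext s t
  simp only [copies, tensorPow, Matrix.of_apply, Matrix.mul_apply, ← Finset.prod_mul_distrib]
  rw [Finset.prod_univ_sum, Fintype.piFinset_univ]
  exact ((Equiv.arrowProdEquivProdArrow (Fin k) (fun _ => m) fun _ => n).symm.sum_comp _).symm

theorem copies_conjTranspose {m n : Type*} (k : ℕ) (ρ : Matrix (m × n) (m × n) ℂ) :
    copies k ρ.conjTranspose = (copies k ρ).conjTranspose := by
  ext s t
  simp [copies, tensorPow, star_prod]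

theorem copies_kronecker {m n : Type*} (k : ℕ) (x : Matrix m m ℂ) (y : Matrix n n ℂ) :
    copies k (x ⊗ₖ y) = tensorPow k x ⊗ₖ tensorPow k y := by
  ext s t
  simp [copies, tensorPow, Finset.prod_mul_distrib]

theorem outcomeProb_eq {dA dB : ℕ} (ρ : Matrix (Fin dA × Fin dB) (Fin dA × Fin dB) ℂ)
    (u : U dA) (v : U dB) (a : Fin dA) (b : Fin dB) :
    outcomeProb ρ u v a b = ((u.1 ⊗ₖ v.1) * ρ * (u.1 ⊗ₖ v.1).conjTranspose) (a, b) (a, b) := by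
  rw [outcomeProb, Matrix.single_kronecker_single, Matrix.trace_single_mul]
  simp

theorem prod_outcomeProb {dA dB k : ℕ} (ρ : Matrix (Fin dA × Fin dB) (Fin dA × Fin dB) ℂ)
    (u : U dA) (v : U dB) (a : Fin k → Fin dA) (b : Fin k → Fin dB) :
    ∏ i, outcomeProb ρ u v (a i) (b i) =
      ((tensorPow k u.1 ⊗ₖ tensorPow k v.1) * copies k ρ *
        (tensorPow k u.1 ⊗ₖ tensorPow k v.1).conjTranspose) (a, b) (a, b) := by
  simp only [outcomeProb_eq]
  rw [← copies_kronecker, ← copies_conjTranspose, ← copies_mul, ← copies_mul]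
  rfl

theorem trace_Mc_mul_copies {dA dB : ℕ} (ρ : Matrix (Fin dA × Fin dB) (Fin dA × Fin dB) ℂ) :
    (Mc dA dB * copies 3 ρ).trace = (ρ * (marginalA ρ ⊗ₖ marginalB ρ)).trace := by
  have h1 : (Mc dA dB * copies 3 ρ).trace = ∑ a : Fin 3 → Fin dA, ∑ b : Fin 3 → Fin dB,
      copies 3 ρ (a, b) (a ∘ Equiv.swap 0 1, b ∘ Equiv.swap 1 2) := by
    rw [Matrix.trace_mul_comm, Matrix.trace, Fintype.sum_prod_type]
    refine Finset.sum_congr rfl fun a _ => Finset.sum_congr rfl fun b _ => ?_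
    rw [Matrix.diag_apply, Matrix.mul_apply,
      Finset.sum_eq_single (a ∘ Equiv.swap 0 1, b ∘ Equiv.swap 1 2)]
    · simp [Mc, permOp_apply]
    · rintro ⟨a', b'⟩ _ hne
      rw [Mc, Matrix.kronecker_apply, permOp_apply, permOp_apply, mul_ite, mul_one, mul_zero,
        ← ite_and, if_neg, mul_zero]
      rintro ⟨rfl, rfl⟩
      exact hne rfl
    · simp
  have h2 : ∀ a : Fin 3 → Fin dA, ∀ b : Fin 3 → Fin dB,
      copies 3 ρ (a, b) (a ∘ Equiv.swap 0 1, b ∘ Equiv.swap 1 2) =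
        ρ (a 0, b 0) (a 1, b 0) * ρ (a 1, b 1) (a 0, b 2) * ρ (a 2, b 2) (a 2, b 1) := by
    intro a b
    simp [copies, tensorPow, Fin.prod_univ_three, Equiv.swap_apply_def]
  simp only [h1, h2, sum_fin_three, Matrix.cons_val]
  -- Dummy indices are named after the copies in `h2`: copy 1 sums over b0 to the A marginal, copy 3
  -- over a2 to the B marginal, and copy 2 remains as ρ itself.
  have h3 : (ρ * (marginalA ρ ⊗ₖ marginalB ρ)).trace = ∑ a1, ∑ b1, ∑ a0, ∑ b2,
      ρ (a1, b1) (a0, b2) * ((∑ b0, ρ (a0, b0) (a1, b0)) * ∑ a2, ρ (a2, b2) (a2, b1)) := by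
    simp only [Matrix.trace, Matrix.diag_apply, Matrix.mul_apply, Fintype.sum_prod_type,
      Matrix.kronecker_apply, marginalA, marginalB, Matrix.of_apply]
  rw [h3, Finset.sum_comm]
  refine Finset.sum_congr rfl fun a1 _ => ?_
  refine Eq.trans ?_ Finset.sum_comm
  refine Finset.sum_congr rfl fun a0 _ => ?_
  calc _ = ∑ a2, ∑ b1, ∑ b2, ∑ b0,
        ρ (a0, b0) (a1, b0) * ρ (a1, b1) (a0, b2) * ρ (a2, b2) (a2, b1) :=
        Finset.sum_congr rfl fun a2 _ =>
          Finset.sum_comm.trans (Finset.sum_congr rfl fun b1 _ => Finset.sum_comm)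
    _ = ∑ b1, ∑ b2, ∑ a2, ∑ b0,
        ρ (a0, b0) (a1, b0) * ρ (a1, b1) (a0, b2) * ρ (a2, b2) (a2, b1) :=
        Finset.sum_comm.trans (Finset.sum_congr rfl fun b1 _ => Finset.sum_comm)
    _ = _ := by
        refine Finset.sum_congr rfl fun b1 _ => Finset.sum_congr rfl fun b2 _ => ?_
        rw [mul_comm (∑ b0, _), Finset.sum_mul_sum, Finset.mul_sum]
        refine Finset.sum_congr rfl fun a2 _ => ?_
        rw [Finset.mul_sum]
        exact Finset.sum_congr rfl fun b0 _ => by ring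

end Copies

/-! ### Averaged outcome probabilities -/

section Estimation

variable {dA dB : ℕ} {μA : Measure (U dA)} [IsProbabilityMeasure μA]
  {μB : Measure (U dB)} [IsProbabilityMeasure μB]

theorem biTwirl_kronecker {k : ℕ} (μA : Measure (U dA)) [IsProbabilityMeasure μA]
    (μB : Measure (U dB)) [IsProbabilityMeasure μB]
    (X : Matrix (Fin k → Fin dA) (Fin k → Fin dA) ℂ)
    (Y : Matrix (Fin k → Fin dB) (Fin k → Fin dB) ℂ) :
    biTwirl k μA μB (X ⊗ₖ Y) = twirl k μA X ⊗ₖ twirl k μB Y := by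
  ext s t
  simp only [biTwirl, twirl, Matrix.of_apply, Matrix.conjTranspose_kronecker,
    ← Matrix.mul_kronecker_mul]
  exact integral_prod_mul (μ := μA) (ν := μB)
    (fun u : U dA => (tensorPow k u.1 * X * (tensorPow k u.1).conjTranspose) s.1 t.1)
    fun v : U dB => (tensorPow k v.1 * Y * (tensorPow k v.1).conjTranspose) s.2 t.2

/-- Cyclicity of the trace moves the unitaries from the state to the product observable. The
integrand then factors over A and B, so each design hypothesis applies to its own side, even if ρ is
correlated. -/
theorem sum_mul_integral_prod_outcomeProb {k : ℕ} (hA : IsUnitaryDesign k μA)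
    (hB : IsUnitaryDesign k μB) (ρ : Matrix (Fin dA × Fin dB) (Fin dA × Fin dB) ℂ)
    (f : (Fin k → Fin dA) → ℝ) (g : (Fin k → Fin dB) → ℝ) :
    ∑ a, ∑ b, ((f a * g b : ℝ) : ℂ) *
        ∫ p : U dA × U dB, ∏ i, outcomeProb ρ p.1 p.2 (a i) (b i) ∂(μA.prod μB) =
      ((twirl k (haarU dA) (diagObs f) ⊗ₖ twirl k (haarU dB) (diagObs g)) *
        copies k ρ).trace := by
  have hcA : Continuous fun p : U dA × U dB => tensorPow k p.1.1 :=
    (continuous_tensorPow k).comp continuous_fst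
  have hcB : Continuous fun p : U dA × U dB => tensorPow k p.2.1 :=
    (continuous_tensorPow k).comp continuous_snd
  have hc : Continuous fun p : U dA × U dB => tensorPow k p.1.1 ⊗ₖ tensorPow k p.2.1 :=
    continuous_matrix fun i j => (hcA.matrix_elem i.1 j.1).mul (hcB.matrix_elem i.2 j.2)
  have hP : ∀ (a : Fin k → Fin dA) (b : Fin k → Fin dB), Continuous fun p : U dA × U dB =>
      ∏ i, outcomeProb ρ p.1 p.2 (a i) (b i) := by
    intro a b
    simp only [prod_outcomeProb]
    exact ((hc.matrix_mul continuous_const).matrix_mul hc.matrix_conjTranspose).matrix_elem _ _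
  have hM : ∀ s t : (Fin k → Fin dA) × (Fin k → Fin dB), Continuous fun p : U dA × U dB =>
      ((tensorPow k p.1.1).conjTranspose * diagObs f * tensorPow k p.1.1) s.1 t.1 *
        ((tensorPow k p.2.1).conjTranspose * diagObs g * tensorPow k p.2.1) s.2 t.2 :=
    fun s t =>
      (((hcA.matrix_conjTranspose.matrix_mul continuous_const).matrix_mul hcA).matrix_elem _ _).mul
      (((hcB.matrix_conjTranspose.matrix_mul continuous_const).matrix_mul hcB).matrix_elem _ _)
  have hpt : ∀ p : U dA × U dB,
      ∑ a, ∑ b, ((f a * g b : ℝ) : ℂ) * ∏ i, outcomeProb ρ p.1 p.2 (a i) (b i) =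
        ∑ s, ∑ t, (((tensorPow k p.1.1).conjTranspose * diagObs f * tensorPow k p.1.1) s.1 t.1 *
          ((tensorPow k p.2.1).conjTranspose * diagObs g * tensorPow k p.2.1) s.2 t.2) *
            copies k ρ t s := by
    intro p
    set T := tensorPow k p.1.1 ⊗ₖ tensorPow k p.2.1 with hT
    have hl : ∑ a, ∑ b, ((f a * g b : ℝ) : ℂ) * ∏ i, outcomeProb ρ p.1 p.2 (a i) (b i) =
        ((diagObs f ⊗ₖ diagObs g) * (T * copies k ρ * T.conjTranspose)).trace := by
      simp only [prod_outcomeProb, diagObs, Matrix.diagonal_kronecker_diagonal, Matrix.trace,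
        Matrix.diag_apply, Matrix.diagonal_mul, Fintype.sum_prod_type, Complex.ofReal_mul, hT]
    have hr : T.conjTranspose * (diagObs f ⊗ₖ diagObs g) * T =
        ((tensorPow k p.1.1).conjTranspose * diagObs f * tensorPow k p.1.1) ⊗ₖ
          ((tensorPow k p.2.1).conjTranspose * diagObs g * tensorPow k p.2.1) := by
      rw [hT, Matrix.conjTranspose_kronecker, ← Matrix.mul_kronecker_mul,
        ← Matrix.mul_kronecker_mul]
    rw [hl, ← Matrix.mul_assoc, Matrix.trace_mul_comm, ← Matrix.mul_assoc, ← Matrix.mul_assoc, hr]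
    simp only [Matrix.trace, Matrix.diag_apply, Matrix.mul_apply (N := copies k ρ)]
    rfl
  simp only [← integral_const_mul]
  have hi1 : ∀ a b, Integrable (fun p : U dA × U dB =>
      ((f a * g b : ℝ) : ℂ) * ∏ i, outcomeProb ρ p.1 p.2 (a i) (b i)) (μA.prod μB) :=
    fun a b => integrable_of_continuous _ (continuous_const.mul (hP a b))
  have hi2 : ∀ s t : (Fin k → Fin dA) × (Fin k → Fin dB), Integrable (fun p : U dA × U dB =>
      (((tensorPow k p.1.1).conjTranspose * diagObs f * tensorPow k p.1.1) s.1 t.1 *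
        ((tensorPow k p.2.1).conjTranspose * diagObs g * tensorPow k p.2.1) s.2 t.2) *
          copies k ρ t s) (μA.prod μB) :=
    fun s t => integrable_of_continuous _ ((hM s t).mul continuous_const)
  simp only [← integral_finsetSum _ fun b _ => hi1 _ b]
  rw [← integral_finsetSum _ fun a _ => integrable_finsetSum _ fun b _ => hi1 a b]
  simp only [hpt]
  rw [integral_finsetSum _ fun s _ => integrable_finsetSum _ fun t _ => hi2 s t]
  simp only [Matrix.trace, Matrix.diag_apply, Matrix.mul_apply (N := copies k ρ)]
  refine Finset.sum_congr rfl fun s _ => ?_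
  rw [integral_finsetSum _ fun t _ => hi2 s t]
  refine Finset.sum_congr rfl fun t _ => ?_
  rw [integral_mul_const, Matrix.kronecker_apply, ← integral_conjTranspose_tensorPow_mul hA,
    ← integral_conjTranspose_tensorPow_mul hB]
  congr 1
  exact integral_prod_mul (μ := μA) (ν := μB)
    (fun u : U dA => ((tensorPow k u.1).conjTranspose * diagObs f * tensorPow k u.1) s.1 t.1)
    fun v : U dB => ((tensorPow k v.1).conjTranspose * diagObs g * tensorPow k v.1) s.2 t.2

end Estimation

end RandomTwirl

open RandomTwirl in
theorem mainTheorem4 (dA dB : ℕ)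
    (μA : Measure (U dA)) [IsProbabilityMeasure μA] (hA : IsUnitaryDesign 3 μA)
    (μB : Measure (U dB)) [IsProbabilityMeasure μB] (hB : IsUnitaryDesign 3 μB) :
    twirl 3 μA (diagObs (coeffA dA)) = permOp dA (Equiv.swap (0 : Fin 3) 1) ∧
    twirl 3 μB (diagObs (coeffB dB)) = permOp dB (Equiv.swap (1 : Fin 3) 2) ∧
    biTwirl 3 μA μB (diagObs (coeffA dA) ⊗ₖ diagObs (coeffB dB)) = Mc dA dB ∧
    ∀ ρ : Matrix (Fin dA × Fin dB) (Fin dA × Fin dB) ℂ, IsState ρ →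
      (ρ * (marginalA ρ ⊗ₖ marginalB ρ)).trace = (Mc dA dB * copies 3 ρ).trace ∧
      (ρ * (marginalA ρ ⊗ₖ marginalB ρ)).trace =
        ∑ a : Fin 3 → Fin dA, ∑ b : Fin 3 → Fin dB,
          ((coeffA dA a * coeffB dB b : ℝ) : ℂ) *
            ∫ p : U dA × U dB, ∏ i : Fin 3, outcomeProb ρ p.1 p.2 (a i) (b i)
              ∂(μA.prod μB) := by
  have h1 := (hA _).trans (twirl_haarU_coeffA dA)
  have h2 := (hB _).trans (twirl_haarU_coeffB dB)
  refine ⟨h1, h2, ?_, fun ρ _ => ⟨(trace_Mc_mul_copies ρ).symm, ?_⟩⟩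
  · rw [biTwirl_kronecker, h1, h2, Mc]
  · rw [sum_mul_integral_prod_outcomeProb hA hB, twirl_haarU_coeffA, twirl_haarU_coeffB,
      ← trace_Mc_mul_copies, Mc]
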